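/- Let $\mathfrak g$ be a four-dimensional Lie algebra over $\mathbb R$, and let $\mathfrak g' = [\mathfrak g,\mathfrak g]$ denote its derived algebra (the commutator), i.e. the linear span of all brackets $[x,y]$ with $x,y\in\mathfrak g$. Then $\mathfrak g'\neq\mathfrak g$. In other words, there does not exist a four-dimensional real Lie algebra $\mathfrak g$ with $\mathfrak g=\mathfrak g'$. -/

import Mathlib

/-!
The argument is a dimension count in the Chevalley–Eilenberg complex of a perfect
four-dimensional Lie algebra `L` over a field `K`. Perfectness makes the differential
`d : L* → Λ²L*`, `d f (x, y) = f ⁅x, y⁆`, injective, and it makes `L` unimodular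
(`LieAlgebra.trace_ad_eq_zero_of_perfect`), so that every exact 4-form vanishes. Therefore
`df ∧ dg = d(f ∧ dg) = 0` for all `f, g ∈ L*`: the image of `d` is a subspace of dimension 4 in
the 6-dimensional space `Λ²L*` which is totally isotropic for the nondegenerate wedge pairing
`Λ²L* × Λ²L* → Λ⁴L* ≅ K`. Such a subspace has dimension at most 3.

In coordinates, for a basis `b`, the identity `df ∧ dg = 0` for all `g` is the vector identity
`LieAlgebra.sum_starDifferential_smul_basisBracket_eq_zero`. It says that the injective map
`f ↦ *df` from `L*` to `K⁶` lands in the kernel of the bracket map `K⁶ ≅ Λ²L → L`; that map is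
surjective, so its kernel has dimension 2.
-/

namespace LieAlgebra

variable {K L : Type*} [Field K] [LieRing L] [LieAlgebra K L]

/-- A linear map that vanishes on all brackets of a perfect Lie algebra is zero. -/
theorem linearMap_eq_zero_of_perfect {V : Type*} [AddCommGroup V] [Module K V]
    (hL : ⁅(⊤ : LieIdeal K L), (⊤ : LieIdeal K L)⁆ = ⊤) (f : L →ₗ[K] V)
    (hf : ∀ x y : L, f ⁅x, y⁆ = 0) : f = 0 := by
  have hspan := congrArg LieSubmodule.toSubmodule hL
  rw [LieSubmodule.lieIdeal_oper_eq_linear_span', LieSubmodule.top_toSubmodule] at hspan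
  refine LinearMap.ext_on hspan ?_
  rintro _ ⟨x, -, y, -, rfl⟩
  simpa using hf x y

/-- A perfect Lie algebra is unimodular, because `x ↦ tr (ad x)` vanishes on brackets. -/
theorem trace_ad_eq_zero_of_perfect
    (hL : ⁅(⊤ : LieIdeal K L), (⊤ : LieIdeal K L)⁆ = ⊤) (x : L) :
    LinearMap.trace K L (LieAlgebra.ad K L x) = 0 := by
  have h := linearMap_eq_zero_of_perfect hL
    ((LinearMap.trace K L).comp (LieAlgebra.ad K L : L →ₗ[K] Module.End K L)) (fun x y => by
      simp [Ring.lie_def, LinearMap.trace_mul_comm K (LieAlgebra.ad K L x)])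
  exact LinearMap.congr_fun h x

/-- The brackets of the vectors of a basis, indexed by the pairs
`01, 02, 03, 12, 13, 23`. -/
noncomputable def basisBracket (b : Module.Basis (Fin 4) K L) : Fin 6 → L :=
  ![⁅b 0, b 1⁆, ⁅b 0, b 2⁆, ⁅b 0, b 3⁆, ⁅b 1, b 2⁆, ⁅b 1, b 3⁆, ⁅b 2, b 3⁆]

/-- The map sending `f ∈ L*` to the coordinates of `*df`, where `d f (x, y) = f ⁅x, y⁆` and `*` is
the identification `Λ²L* ≅ Λ²L` given by the volume form of the basis `b`. The order of the
coordinates is that of `basisBracket`. -/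
noncomputable def starDifferential (b : Module.Basis (Fin 4) K L) :
    Module.Dual K L →ₗ[K] (Fin 6 → K) where
  toFun f := ![f ⁅b 2, b 3⁆, -f ⁅b 1, b 3⁆, f ⁅b 1, b 2⁆,
    f ⁅b 0, b 3⁆, -f ⁅b 0, b 2⁆, f ⁅b 0, b 1⁆]
  map_add' f g := by
    ext i; fin_cases i <;> simp [add_comm]
  map_smul' c f := by
    ext i; fin_cases i <;> simp

/-- A linear map that vanishes on the brackets `⁅b i, b j⁆` with `i < j` vanishes on all
brackets. -/
theorem map_lie_eq_zero_of_basisBracket {V : Type*} [AddCommGroup V] [Module K V]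
    (b : Module.Basis (Fin 4) K L) (f : L →ₗ[K] V) (hf : ∀ p, f (basisBracket b p) = 0)
    (x y : L) : f ⁅x, y⁆ = 0 := by
  have h01 : f ⁅b 0, b 1⁆ = 0 := hf 0
  have h02 : f ⁅b 0, b 2⁆ = 0 := hf 1
  have h03 : f ⁅b 0, b 3⁆ = 0 := hf 2
  have h12 : f ⁅b 1, b 2⁆ = 0 := hf 3
  have h13 : f ⁅b 1, b 3⁆ = 0 := hf 4
  have h23 : f ⁅b 2, b 3⁆ = 0 := hf 5
  have hneg (i j : Fin 4) (h : f ⁅b i, b j⁆ = 0) : f ⁅b j, b i⁆ = 0 := by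
    rw [← lie_skew, map_neg, h, neg_zero]
  have hbil : (LieAlgebra.ad K L : L →ₗ[K] Module.End K L).compr₂ f = 0 := by
    refine b.ext fun i => b.ext fun j => ?_
    fin_cases i <;> fin_cases j <;>
      simp [h01, h02, h03, h12, h13, h23, hneg _ _ h01, hneg _ _ h02, hneg _ _ h03,
        hneg _ _ h12, hneg _ _ h13, hneg _ _ h23]
  exact LinearMap.congr_fun₂ hbil x y

/-- In a unimodular Lie algebra with basis `b 0, …, b 3` one has `df ∧ dg = 0` for all linear forms
`f, g`; the left-hand side is `df ∧ dg` evaluated at `(b 0, b 1, b 2, b 3)`. -/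
theorem wedge_differential_eq_zero (b : Module.Basis (Fin 4) K L)
    (htr : ∀ x : L, LinearMap.trace K L (LieAlgebra.ad K L x) = 0) (f g : Module.Dual K L) :
    f ⁅b 2, b 3⁆ * g ⁅b 0, b 1⁆ - f ⁅b 1, b 3⁆ * g ⁅b 0, b 2⁆ + f ⁅b 1, b 2⁆ * g ⁅b 0, b 3⁆
      + f ⁅b 0, b 3⁆ * g ⁅b 1, b 2⁆ - f ⁅b 0, b 2⁆ * g ⁅b 1, b 3⁆
      + f ⁅b 0, b 1⁆ * g ⁅b 2, b 3⁆ = 0 := by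
  let c (i j k : Fin 4) : K := b.repr ⁅b i, b j⁆ k
  have hf (i j : Fin 4) : f ⁅b i, b j⁆ = ∑ k, c i j k * f (b k) := by
    conv_lhs => rw [← b.sum_repr ⁅b i, b j⁆]
    simp only [map_sum, map_smul, smul_eq_mul, c]
  have hg (i j l : Fin 4) : g ⁅b l, ⁅b i, b j⁆⁆ = ∑ k, c i j k * g ⁅b l, b k⁆ := by
    conv_lhs => rw [← b.sum_repr ⁅b i, b j⁆]
    simp only [lie_sum, lie_smul, map_sum, map_smul, smul_eq_mul, c]
  have hcskew (i j k : Fin 4) : c i j k = -c j i k := by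
    simp only [c, ← lie_skew (b j) (b i), map_neg, Finsupp.neg_apply, neg_neg]
  have hcself (i k : Fin 4) : c i i k = 0 := by simp [c]
  have hgskew (i j : Fin 4) : g ⁅b i, b j⁆ = -g ⁅b j, b i⁆ := by
    rw [← lie_skew, map_neg]
  have htrace (i : Fin 4) : ∑ k, c i k k = 0 := by
    rw [← htr (b i), LinearMap.trace_eq_matrix_trace K b, Matrix.trace]
    simp [LinearMap.toMatrix_apply, c]
  -- The Jacobi identity, in the form `d (dg) = 0`.
  have hjac (i j l : Fin 4) : ∑ k, c i j k * g ⁅b l, b k⁆ + ∑ k, c j l k * g ⁅b i, b k⁆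
      + ∑ k, c l i k * g ⁅b j, b k⁆ = 0 := by
    rw [← hg, ← hg, ← hg, ← map_add, ← map_add, add_comm ⁅b l, _⁆, add_right_comm, add_assoc,
      add_comm ⁅b j, _⁆, ← add_assoc, add_right_comm, lie_jacobi, map_zero]
  have j012 := hjac 0 1 2
  have j013 := hjac 0 1 3
  have j023 := hjac 0 2 3
  have j123 := hjac 1 2 3
  have t0 := htrace 0
  have t1 := htrace 1
  have t2 := htrace 2
  have t3 := htrace 3
  simp only [Fin.sum_univ_four, hcself, lie_self, map_zero, hcskew 1 0, hcskew 2 0, hcskew 3 0,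
    hcskew 2 1, hcskew 3 1, hcskew 3 2, hgskew 1 0, hgskew 2 0, hgskew 3 0,
    hgskew 2 1, hgskew 3 1, hgskew 3 2] at j012 j013 j023 j123 t0 t1 t2 t3
  rw [hf, hf, hf, hf, hf, hf]
  simp only [Fin.sum_univ_four]
  -- `df ∧ dg = f ∧ d (dg) + d (f ∧ dg)`, and up to sign the last term is the wedge product of the
  -- linear form `x ↦ tr (ad x)` with the 3-form `f ∧ dg`.
  linear_combination
    -(f (b 0) * j123 - f (b 1) * j023 + f (b 2) * j013 - f (b 3) * j012)
    + (t0 * (f (b 1) * g ⁅b 2, b 3⁆ - f (b 2) * g ⁅b 1, b 3⁆ + f (b 3) * g ⁅b 1, b 2⁆)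
      - t1 * (f (b 0) * g ⁅b 2, b 3⁆ - f (b 2) * g ⁅b 0, b 3⁆ + f (b 3) * g ⁅b 0, b 2⁆)
      + t2 * (f (b 0) * g ⁅b 1, b 3⁆ - f (b 1) * g ⁅b 0, b 3⁆ + f (b 3) * g ⁅b 0, b 1⁆)
      - t3 * (f (b 0) * g ⁅b 1, b 2⁆ - f (b 1) * g ⁅b 0, b 2⁆ + f (b 2) * g ⁅b 0, b 1⁆))

/-- The kernel relation `∑ (*df)ₚ vₚ = 0`, where `vₚ` are the brackets of basis vectors. -/
theorem sum_starDifferential_smul_basisBracket_eq_zero (b : Module.Basis (Fin 4) K L)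
    (htr : ∀ x : L, LinearMap.trace K L (LieAlgebra.ad K L x) = 0) (f : Module.Dual K L) :
    Fintype.linearCombination K (basisBracket b) (starDifferential b f) = 0 := by
  refine (Module.forall_dual_apply_eq_zero_iff K _).mp fun g => ?_
  rw [← wedge_differential_eq_zero b htr f g]
  simp only [Fintype.linearCombination_apply, Fin.sum_univ_six, map_add, map_smul, smul_eq_mul]
  simp [starDifferential, basisBracket]
  ring

theorem lie_top_top_ne_top_of_finrank_eq_four (hdim : Module.finrank K L = 4) :
    ⁅(⊤ : LieIdeal K L), (⊤ : LieIdeal K L)⁆ ≠ (⊤ : LieIdeal K L) := by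
  intro hL
  have : FiniteDimensional K L := .of_finrank_pos (by lia)
  let b : Module.Basis (Fin 4) K L := Module.finBasisOfFinrankEq K L hdim
  -- `S` is the bracket map `Λ²L → L`.
  let S := Fintype.linearCombination K (basisBracket b)
  have hS : LinearMap.range S = ⊤ := by
    rw [← Submodule.ker_mkQ (LinearMap.range S), LinearMap.ker_eq_top]
    refine linearMap_eq_zero_of_perfect hL _ (map_lie_eq_zero_of_basisBracket b _ fun p => ?_)
    rw [Submodule.mkQ_apply, Submodule.Quotient.mk_eq_zero, Fintype.range_linearCombination]
    exact Submodule.subset_span ⟨p, rfl⟩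
  have hD : Function.Injective (starDifferential b) := by
    rw [← LinearMap.ker_eq_bot, LinearMap.ker_eq_bot']
    intro f hf
    refine linearMap_eq_zero_of_perfect hL f (map_lie_eq_zero_of_basisBracket b f fun p => ?_)
    have h (q : Fin 6) : starDifferential b f q = 0 := congrFun hf q
    fin_cases p
    · exact h 5
    · exact neg_eq_zero.mp (h 4)
    · exact h 3
    · exact h 2
    · exact neg_eq_zero.mp (h 1)
    · exact h 0
  have hle : LinearMap.range (starDifferential b) ≤ LinearMap.ker S := by
    rintro _ ⟨f, rfl⟩
    exact sum_starDifferential_smul_basisBracket_eq_zero b (trace_ad_eq_zero_of_perfect hL) f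
  -- The injective image of `L*` has dimension 4, while `ker S` has dimension `6 - 4 = 2`.
  have h1 := Submodule.finrank_mono hle
  rw [LinearMap.finrank_range_of_inj hD, Subspace.dual_finrank_eq, hdim] at h1
  have h2 := S.finrank_range_add_finrank_ker
  rw [hS, finrank_top, hdim, Module.finrank_fin_fun] at h2
  lia

end LieAlgebra

theorem lemma1 (𝔤 : Type*) [LieRing 𝔤] [LieAlgebra ℝ 𝔤] (hdim : Module.finrank ℝ 𝔤 = 4) :
    ⁅(⊤ : LieIdeal ℝ 𝔤), (⊤ : LieIdeal ℝ 𝔤)⁆ ≠ (⊤ : LieIdeal ℝ 𝔤) := by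
  exact LieAlgebra.lie_top_top_ne_top_of_finrank_eq_four hdim
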